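/- For positive integers $n,k$ with $n>2k$, let $K(n,k)$ be the Kneser graph, whose vertices are the $k$-element subsets of $\{1,\dots,n\}$, two of them being adjacent if and only if they are disjoint. The determining number of a finite graph $G$ is the minimum cardinality of a set $S$ of vertices such that the identity is the only automorphism of $G$ fixing every vertex of $S$. For an integer $r\ge 2$, let $f(r)$ be the number of Kneser graphs $K(n,k)$ (that is, of pairs $(n,k)$ of positive integers with $n>2k$) whose determining number equals $r$, and let $F(r)$ be the number of those whose determining number is at most $r$. Then $f(r)$ and $F(r)$ are finite, $f$ is strictly increasing on the integers $r\ge 2$, and for every integer $r\ge 2$ $$f(r+1)\;\ge\;\sum_{k=2}^{r} f(k)\qquad\text{and}\qquad F(r+1)\;\ge\;2F(r).$$ -/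

import Mathlib

/-- The Kneser graph `K(n,k)`: its vertices are the `k`-subsets of an `n`-set, and two distinct
vertices are adjacent when they are disjoint (for `k ≥ 1` disjoint `k`-subsets are automatically
distinct). -/
def kneserGraph (n k : ℕ) : SimpleGraph {s : Finset (Fin n) // s.card = k} where
  Adj s t := s ≠ t ∧ Disjoint s.1 t.1
  symm := ⟨fun _ _ h => ⟨h.1.symm, h.2.symm⟩⟩
  loopless := ⟨fun _ h => h.1 rfl⟩

/-- `S` is a determining set of `G`: the only automorphism of `G` fixing every vertex of `S`
is the identity. -/
def IsDeterminingSet {V : Type*} (G : SimpleGraph V) (S : Finset V) : Prop :=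
  ∀ σ : G ≃g G, (∀ v ∈ S, σ v = v) → ∀ v, σ v = v

/-- The determining number of a finite graph: the minimum cardinality of a determining set.
The whole vertex set is a determining set, so the infimum is over a nonempty set. -/
noncomputable def determiningNumber {V : Type*} [Fintype V] (G : SimpleGraph V) : ℕ :=
  sInf {m : ℕ | ∃ S : Finset V, S.card = m ∧ IsDeterminingSet G S}

/-- The parameters `(n, k)`, with `k ≥ 1` and `n > 2k`, of the Kneser graphs `K(n,k)` of
determining number `r`. -/
def kneserWithDet (r : ℕ) : Set (ℕ × ℕ) :=
  {p | 1 ≤ p.2 ∧ 2 * p.2 < p.1 ∧ determiningNumber (kneserGraph p.1 p.2) = r}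

/-- The parameters `(n, k)`, with `k ≥ 1` and `n > 2k`, of the Kneser graphs `K(n,k)` of
determining number at most `r`. -/
def kneserWithDetLE (r : ℕ) : Set (ℕ × ℕ) :=
  {p | 1 ≤ p.2 ∧ 2 * p.2 < p.1 ∧ determiningNumber (kneserGraph p.1 p.2) ≤ r}

/-- `f(r)`: the number of Kneser graphs with determining number `r`. -/
noncomputable def kneserCount (r : ℕ) : ℕ := (kneserWithDet r).ncard

/-- `F(r)`: the number of Kneser graphs with determining number at most `r`. -/
noncomputable def kneserCountLE (r : ℕ) : ℕ := (kneserWithDetLE r).ncard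

/-! Record, for each point of the ground set, which of r given vertices contain it. These traces are
subsets of an r-set, each index lying in exactly k of them. Automorphisms of K(n,k) come from
permutations of the points, so the vertices are determining exactly when the traces are distinct.
Hence determining number at most r means a k-regular family of n subsets of an r-set, which forces n
≤ 2^r.

Overlaying such a family on the power set of r points, using one new point, sends (n,k) injectively
to (2^r + n, 2^(r-1) + k), whose determining number is exactly r + 1 since 2^r + n > 2^r. The family
{∅}, with (n,k) = (1,0), is not a Kneser pair but also has an image, so F(r) < f(r+1). All the
inequalities follow from this and F(r+1) = F(r) + f(r+1). -/

open Finset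

/-! ### Automorphisms of Kneser graphs -/

/-- More than `k + 3` sets of size `k + 2`, any two of them meeting in `k + 1` elements, have
`k + 1` common elements. -/
theorem exists_common_subset_of_pairwise_card_inter {α : Type*} [DecidableEq α] {k : ℕ}
    (F : Finset (Finset α)) (hcard : ∀ A ∈ F, #A = k + 2)
    (hF : ∀ A ∈ F, ∀ B ∈ F, A ≠ B → #(A ∩ B) = k + 1) (hlarge : k + 3 < #F) :
    ∃ T : Finset α, #T = k + 1 ∧ ∀ A ∈ F, T ⊆ A := by
  obtain ⟨A, hA, B, hB, hAB⟩ := one_lt_card.1 (show 1 < #F by omega)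
  refine ⟨A ∩ B, hF A hA B hB hAB, ?_⟩
  have hU : #(A ∪ B) = k + 3 := by
    have h1 := card_union_add_card_inter A B
    have h2 := hF A hA B hB hAB
    have h3 := hcard A hA
    have h4 := hcard B hB
    omega
  -- Here `C` meets `A ∩ B` in at most `k` points, so `C ∩ A` and `C ∩ B`, of size `k + 1` each,
  -- already fill `C`.
  have key : ∀ C ∈ F, ¬ A ∩ B ⊆ C → C ⊆ A ∪ B := by
    intro C hC hTC
    have hCA : C ≠ A := fun h => hTC (h ▸ inter_subset_left)
    have hCB : C ≠ B := fun h => hTC (h ▸ inter_subset_right)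
    have h1 := hF C hC A hA hCA
    have h2 := hF C hC B hB hCB
    have h3 : (C ∩ A) ∩ (C ∩ B) ⊂ A ∩ B := by
      refine ⟨fun x hx => by simp at hx ⊢; tauto, fun h => hTC fun x hx => ?_⟩
      exact (mem_inter.1 (mem_inter.1 (h hx)).1).1
    have h4 := card_lt_card h3
    rw [hF A hA B hB hAB] at h4
    have h5 := card_union_add_card_inter (C ∩ A) (C ∩ B)
    have h6 : (C ∩ A) ∪ (C ∩ B) = C :=
      eq_of_subset_of_card_le (union_subset inter_subset_left inter_subset_left)
        (by rw [hcard C hC]; omega)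
    rw [← inter_union_distrib_left] at h6
    exact h6 ▸ inter_subset_right
  by_contra hcon
  push Not at hcon
  obtain ⟨C, hC, hTC⟩ := hcon
  -- One member `C` not containing `A ∩ B` confines every member to `A ∪ B`, which has only `k + 3`
  -- subsets of size `k + 2`. A member `D` leaving `A ∪ B` would contain `A ∩ B`, hence two points
  -- outside `C`.
  have hall : F ⊆ (A ∪ B).powersetCard (k + 2) := by
    intro D hD
    rw [mem_powersetCard]
    refine ⟨?_, hcard D hD⟩
    by_contra hDU
    have hTD : A ∩ B ⊆ D := by
      by_contra h
      exact hDU (key D hD h)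
    have hCU := key C hC hTC
    have hDC : D ≠ C := fun h => hDU (h ▸ hCU)
    have h1 := hF D hD C hC hDC
    obtain ⟨d, hdD, hdU⟩ := not_subset.1 hDU
    obtain ⟨t, htT, htC⟩ := not_subset.1 hTC
    have h2 : D ∩ C ⊆ (D.erase d).erase t := by
      intro x hx
      rw [mem_inter] at hx
      refine mem_erase.2 ⟨fun h => htC (h ▸ hx.2), mem_erase.2 ⟨fun h => hdU (hCU (h ▸ hx.2)), hx.1⟩⟩
    have h3 := card_le_card h2
    have hdt : t ≠ d := by
      rintro rfl
      exact hdU (mem_union_left _ (mem_inter.1 htT).1)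
    rw [card_erase_of_mem (mem_erase.2 ⟨hdt, hTD htT⟩), card_erase_of_mem hdD, hcard D hD] at h3
    omega
  have h := card_le_card hall
  rw [card_powersetCard, hU, Nat.choose_succ_self_right] at h
  omega

/-- A `k`-set has as many supersets of size `k + 1` as there are points outside it. -/
theorem card_supersets_card_succ {α : Type*} [Fintype α] [DecidableEq α] {k : ℕ} (T : Finset α)
    (hT : #T = k) :
    #(univ.filter fun s : {s : Finset α // #s = k + 1} => T ⊆ s.1) = Fintype.card α - k := by
  rw [← hT, ← card_compl]
  symm
  refine card_bij (fun x hx => ⟨insert x T, ?_⟩) ?_ ?_ ?_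
  · rw [card_insert_of_notMem (mem_compl.1 hx), hT]
  · intro x hx
    simp
  · intro x hx y hy h
    have h' : insert x T = insert y T := congrArg Subtype.val h
    have : x ∈ insert y T := h' ▸ mem_insert_self x T
    exact (mem_insert.1 this).resolve_right (mem_compl.1 hx)
  · rintro ⟨s, hs⟩ h
    simp only [mem_filter, mem_univ, true_and] at h
    have h1 : #(s \ T) = 1 := by
      rw [card_sdiff_of_subset h]
      omega
    obtain ⟨x, hx⟩ := card_eq_one.1 h1
    have hxm : x ∈ s \ T := hx ▸ mem_singleton_self x
    refine ⟨x, mem_compl.2 (mem_sdiff.1 hxm).2, Subtype.ext ?_⟩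
    show insert x T = s
    rw [insert_eq, ← hx, sdiff_union_of_subset h]

/-- An injective self-map of the `(k + 1)`-subsets of a set with more than `2 (k + 1)` elements
that preserves meeting in `k` elements is induced by a permutation. -/
theorem exists_perm_of_preserves_card_inter {α : Type*} [Fintype α] [DecidableEq α] (k : ℕ)
    (hk : 2 * (k + 1) < Fintype.card α)
    (σ : {s : Finset α // #s = k + 1} → {s : Finset α // #s = k + 1})
    (hσ : Function.Injective σ)
    (hadj : ∀ s t, #(s.1 ∩ t.1) = k → #((σ s).1 ∩ (σ t).1) = k) :
    ∃ π : Equiv.Perm α, ∀ s, (σ s).1 = s.1.image π := by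
  induction k with
  | zero =>
    choose p hp using fun x : α => card_eq_one.1 (σ ⟨{x}, card_singleton x⟩).2
    have hinj : Function.Injective p := by
      intro x y hxy
      have : σ ⟨{x}, card_singleton x⟩ = σ ⟨{y}, card_singleton y⟩ :=
        Subtype.ext (by rw [hp, hp, hxy])
      simpa using hσ this
    refine ⟨Equiv.ofBijective p (Finite.injective_iff_bijective.1 hinj), ?_⟩
    rintro ⟨s, hs⟩
    obtain ⟨x, rfl⟩ := card_eq_one.1 hs
    simp [hp]
  | succ k ih =>
    -- The supersets of `T` number `card α - (k + 1) > k + 3`, so their images again share a `(k +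
    -- 1)`-set. This gives a map one level down, to which induction applies.
    have hstar : ∀ T : {s : Finset α // #s = k + 1}, ∃ T' : Finset α, #T' = k + 1 ∧
        ∀ s, T.1 ⊆ s.1 → T' ⊆ (σ s).1 := by
      intro T
      let F := (univ.filter fun s : {s : Finset α // #s = k + 1 + 1} => T.1 ⊆ s.1).image
        (fun s => (σ s).1)
      suffices h : ∃ T' : Finset α, #T' = k + 1 ∧ ∀ A ∈ F, T' ⊆ A by
        obtain ⟨T', hT', hsub⟩ := h
        refine ⟨T', hT', fun s hs => hsub _ (mem_image_of_mem _ ?_)⟩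
        simpa using hs
      apply exists_common_subset_of_pairwise_card_inter (k := k)
      · intro A hA
        obtain ⟨s, -, rfl⟩ := mem_image.1 hA
        exact (σ s).2
      · intro A hA B hB hAB
        obtain ⟨s, hs, rfl⟩ := mem_image.1 hA
        obtain ⟨t, ht, rfl⟩ := mem_image.1 hB
        have hs' := (mem_filter.1 hs).2
        have ht' := (mem_filter.1 ht).2
        apply hadj
        have hst : s.1 ≠ t.1 := fun h => hAB (by rw [Subtype.ext h])
        have h1 := card_le_card (subset_inter hs' ht')
        rw [T.2] at h1
        by_contra hne
        have h2 := card_le_card (inter_subset_left (s₁ := s.1) (s₂ := t.1))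
        rw [s.2] at h2
        have h3 : s.1 ∩ t.1 = s.1 := eq_of_subset_of_card_le inter_subset_left (by rw [s.2]; omega)
        have h4 : s.1 = t.1 :=
          eq_of_subset_of_card_le (inter_eq_left.1 h3) (by rw [s.2, t.2])
        exact hst h4
      · have hFcard := card_image_of_injective
          (univ.filter fun s : {s : Finset α // #s = k + 1 + 1} => T.1 ⊆ s.1)
          (Subtype.val_injective.comp hσ)
        rw [card_supersets_card_succ T.1 T.2] at hFcard
        change k + 3 < #(image (Subtype.val ∘ σ) _)
        rw [hFcard]
        omega
    choose τ' hτcard hτ using hstar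
    let τ : {s : Finset α // #s = k + 1} → {s : Finset α // #s = k + 1} :=
      fun T => ⟨τ' T, hτcard T⟩
    have hτinj : Function.Injective τ := by
      intro T₁ T₂ h
      have h' : τ' T₁ = τ' T₂ := congrArg Subtype.val h
      -- Both families of supersets map into the supersets of one set, which are no more numerous
      -- than either family; so the two families coincide.
      have hsame : ∀ s : {s : Finset α // #s = k + 1 + 1}, T₁.1 ⊆ s.1 → T₂.1 ⊆ s.1 := by
        set S₁ := univ.filter fun s : {s : Finset α // #s = k + 1 + 1} => T₁.1 ⊆ s.1 with hS₁
        set S₂ := univ.filter fun s : {s : Finset α // #s = k + 1 + 1} => T₂.1 ⊆ s.1 with hS₂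
        have hle : #(S₁ ∪ S₂) ≤ #S₂ := by
          rw [← card_image_of_injective _ hσ, card_supersets_card_succ T₂.1 T₂.2,
            ← card_supersets_card_succ (τ' T₁) (hτcard T₁)]
          refine card_le_card fun t ht => ?_
          obtain ⟨s, hs, rfl⟩ := mem_image.1 ht
          simp only [hS₁, hS₂, mem_union, mem_filter, mem_univ, true_and] at hs ⊢
          exact hs.elim (hτ T₁ s) fun hs => h' ▸ hτ T₂ s hs
        have heq := eq_of_subset_of_card_le (subset_union_right (s₁ := S₁) (s₂ := S₂)) hle
        intro s hs
        have : s ∈ S₂ := heq ▸ mem_union_left _ (by simpa [hS₁] using hs)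
        simpa [hS₂] using this
      by_contra hne
      have hnot : ¬ T₂.1 ⊆ T₁.1 := fun hsub =>
        hne (Subtype.ext (eq_of_subset_of_card_le hsub (by rw [T₁.2, T₂.2])).symm)
      obtain ⟨y, hy₂, hy₁⟩ := not_subset.1 hnot
      have hlt : #(insert y T₁.1) < Fintype.card α := by
        rw [card_insert_of_notMem hy₁, T₁.2]
        omega
      obtain ⟨x, -, hx⟩ := exists_mem_notMem_of_card_lt_card (t := univ) hlt
      rw [mem_insert, not_or] at hx
      have := hsame ⟨insert x T₁.1, by rw [card_insert_of_notMem hx.2, T₁.2]⟩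
        (subset_insert _ _) hy₂
      rcases mem_insert.1 this with h | h
      · exact hx.1 h.symm
      · exact hy₁ h
    obtain ⟨π, hπ⟩ := ih (by omega) τ hτinj (by
      intro T₁ T₂ h
      have hne : T₁ ≠ T₂ := by
        rintro rfl
        rw [inter_self, T₁.2] at h
        omega
      -- Both images lie in the `(k + 2)`-set `σ (T₁ ∪ T₂)`, so they meet in at least `k` points;
      -- injectivity excludes `k + 1`.
      have hU : #(T₁.1 ∪ T₂.1) = k + 1 + 1 := by
        have := card_union_add_card_inter T₁.1 T₂.1
        rw [T₁.2, T₂.2] at this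
        omega
      have h1 := hτ T₁ ⟨_, hU⟩ subset_union_left
      have h2 := hτ T₂ ⟨_, hU⟩ subset_union_right
      have h3 := card_le_card (union_subset h1 h2)
      rw [(σ _).2] at h3
      have h4 := card_union_add_card_inter (τ' T₁) (τ' T₂)
      rw [hτcard, hτcard] at h4
      have h5 : #(τ' T₁ ∩ τ' T₂) < k + 1 := by
        by_contra hcon
        have h6 : τ' T₁ ∩ τ' T₂ = τ' T₁ :=
          eq_of_subset_of_card_le inter_subset_left (by rw [hτcard]; omega)
        exact hne (hτinj (Subtype.ext (eq_of_subset_of_card_le (inter_eq_left.1 h6)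
          (by rw [hτcard, hτcard]))))
      show #(τ' T₁ ∩ τ' T₂) = k
      omega)
    refine ⟨π, fun s => ?_⟩
    symm
    refine eq_of_subset_of_card_le (fun y hy => ?_) ?_
    · obtain ⟨x, hx, rfl⟩ := mem_image.1 hy
      obtain ⟨z, hz, hzx⟩ := exists_mem_ne (show 1 < #s.1 by rw [s.2]; omega) x
      have hT : #(s.1.erase z) = k + 1 := by rw [card_erase_of_mem hz, s.2]; omega
      have h1 := hτ ⟨_, hT⟩ s (erase_subset _ _)
      apply h1
      have h2 := hπ ⟨_, hT⟩
      change τ' ⟨_, hT⟩ = _ at h2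
      rw [h2]
      exact mem_image_of_mem _ (mem_erase.2 ⟨hzx.symm, hx⟩)
    · rw [card_image_of_injective _ π.injective, (σ s).2, s.2]

/-- Common neighbors are the `k`-subsets of the complement of `s ∪ t`, so the graph structure
detects the size of the union. -/
theorem card_commonNeighbors_kneserGraph {n k : ℕ} (hk : 1 ≤ k)
    (s t : {s : Finset (Fin n) // #s = k}) :
    Nat.card {w // (kneserGraph n k).Adj s w ∧ (kneserGraph n k).Adj t w}
      = (n - #(s.1 ∪ t.1)).choose k := by
  classical
  have hc : n - #(s.1 ∪ t.1) = #(s.1 ∪ t.1)ᶜ := by rw [card_compl, Fintype.card_fin]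
  rw [hc, ← card_powersetCard, ← Nat.card_eq_finsetCard]
  have hne : ∀ {A B : {s : Finset (Fin n) // #s = k}}, Disjoint A.1 B.1 → A ≠ B := by
    rintro A B h rfl
    rw [disjoint_self_iff_empty] at h
    have := A.2
    rw [h, card_empty] at this
    omega
  refine Nat.card_congr
    { toFun := fun w => ⟨w.1.1, mem_powersetCard.2 ⟨?_, w.1.2⟩⟩
      invFun := fun u => ⟨⟨u.1, (mem_powersetCard.1 u.2).2⟩, ?_⟩
      left_inv := fun _ => rfl
      right_inv := fun _ => rfl }
  · rw [subset_compl_iff_disjoint_right, disjoint_union_right]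
    exact ⟨w.2.1.2.symm, w.2.2.2.symm⟩
  · have h := (mem_powersetCard.1 u.2).1
    rw [subset_compl_iff_disjoint_right, disjoint_union_right] at h
    exact ⟨⟨hne h.1.symm, h.1.symm⟩, ⟨hne h.2.symm, h.2.symm⟩⟩

/-- Every automorphism of a Kneser graph `K(n,k)` with `n > 2k` is induced by a permutation. -/
theorem exists_perm_of_kneserGraph_iso {n k : ℕ} (hk : 1 ≤ k) (hn : 2 * k < n)
    (σ : kneserGraph n k ≃g kneserGraph n k) :
    ∃ π : Equiv.Perm (Fin n), ∀ s, (σ s).1 = s.1.image π := by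
  obtain ⟨k, rfl⟩ := Nat.exists_eq_add_of_le' hk
  refine exists_perm_of_preserves_card_inter k (by simpa using hn) σ σ.injective ?_
  intro s t hst
  have h1 : (n - #(s.1 ∪ t.1)).choose (k + 1) = (n - #((σ s).1 ∪ (σ t).1)).choose (k + 1) := by
    rw [← card_commonNeighbors_kneserGraph hk, ← card_commonNeighbors_kneserGraph hk]
    refine Nat.card_congr (σ.toEquiv.subtypeEquiv fun w => ?_)
    exact (and_congr σ.map_adj_iff σ.map_adj_iff).symm
  have h2 := card_union_add_card_inter s.1 t.1
  have h3 := card_union_add_card_inter (σ s).1 (σ t).1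
  rw [s.2, t.2] at h2
  rw [(σ s).2, (σ t).2] at h3
  -- Binomials with lower index `k + 1` are injective only away from their zeros; `#(s ∪ t) = k + 2`
  -- and `n > 2 (k + 1)` keep the known side nonzero.
  have hpascal : ∀ m, k + 1 ≤ m → (m - 1).choose (k + 1) < m.choose (k + 1) := by
    intro m hm
    obtain ⟨m, rfl⟩ := Nat.exists_eq_add_of_le' (show 1 ≤ m by omega)
    rw [Nat.choose_succ_succ', Nat.add_sub_cancel]
    have := Nat.choose_pos (show k ≤ m by omega)
    omega
  have h4 : n - #(s.1 ∪ t.1) = n - #((σ s).1 ∪ (σ t).1) := by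
    rcases lt_trichotomy (n - #(s.1 ∪ t.1)) (n - #((σ s).1 ∪ (σ t).1)) with h | h | h
    · have h5 := hpascal (n - #((σ s).1 ∪ (σ t).1)) (by omega)
      have h6 := Nat.choose_le_choose (k + 1) (Nat.le_sub_one_of_lt h)
      omega
    · exact h
    · have h5 := hpascal (n - #(s.1 ∪ t.1)) (by omega)
      have h6 := Nat.choose_le_choose (k + 1) (Nat.le_sub_one_of_lt h)
      omega
  omega

/-! ### Determining sets as regular families -/

/-- The automorphism of a Kneser graph induced by a permutation of the ground set. -/
def kneserGraphIsoOfPerm {n k : ℕ} (π : Equiv.Perm (Fin n)) :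
    kneserGraph n k ≃g kneserGraph n k where
  toEquiv := π.finsetCongr.subtypeEquiv fun s => by simp
  map_rel_iff' := by
    intro s t
    exact and_congr (Equiv.injective _).ne_iff (disjoint_map _)

/-- There are `n` distinct subsets of `ι` such that each point of `ι` lies in exactly `k`. -/
def HasRegularFamily (ι : Type*) [DecidableEq ι] (n k : ℕ) : Prop :=
  ∃ H : Finset (Finset ι), #H = n ∧ ∀ i, #(H.filter fun A => i ∈ A) = k

theorem determiningNumber_le_iff {V : Type*} [Fintype V] (G : SimpleGraph V) (r : ℕ) :
    determiningNumber G ≤ r ↔ ∃ S : Finset V, #S ≤ r ∧ IsDeterminingSet G S := by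
  constructor
  · intro h
    have hne : {m : ℕ | ∃ S : Finset V, #S = m ∧ IsDeterminingSet G S}.Nonempty :=
      ⟨#(univ : Finset V), univ, rfl, fun _ h v => h v (mem_univ v)⟩
    obtain ⟨S, hS, hdet⟩ := Nat.sInf_mem hne
    exact ⟨S, hS.le.trans h, hdet⟩
  · rintro ⟨S, hS, hdet⟩
    exact le_trans (Nat.sInf_le (m := #S) ⟨S, rfl, hdet⟩) hS

/-- `K(n,k)` has a determining set of at most `r` vertices exactly when some `k`-regular family
consists of `n` subsets of an `r`-set: the family lists, for each point, the vertices containing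
it. -/
theorem determiningNumber_kneserGraph_le_iff {ι : Type*} [Fintype ι] [DecidableEq ι] {n k : ℕ}
    (hk : 1 ≤ k) (hn : 2 * k < n) :
    determiningNumber (kneserGraph n k) ≤ Fintype.card ι ↔ HasRegularFamily ι n k := by
  rw [determiningNumber_le_iff]
  constructor
  · rintro ⟨S, hS, hdet⟩
    obtain ⟨f⟩ : Nonempty (S ↪ ι) :=
      Function.Embedding.nonempty_of_card_le (by rwa [Fintype.card_coe])
    obtain ⟨s₀, -, hs₀⟩ := exists_subset_card_eq (s := (univ : Finset (Fin n))) (n := k)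
      (by rw [card_univ, Fintype.card_fin]; omega)
    -- Unused indices are padded with the arbitrary vertex `s₀`.
    let g : ι → {s : Finset (Fin n) // #s = k} :=
      Function.extend f Subtype.val fun _ => ⟨s₀, hs₀⟩
    have hg : ∀ s ∈ S, ∃ i, g i = s := fun s hs => ⟨f ⟨s, hs⟩, f.injective.extend_apply _ _ _⟩
    let v : Fin n → Finset ι := fun x => univ.filter fun i => x ∈ (g i).1
    have hv : Function.Injective v := by
      intro x y hxy
      by_contra hne
      have hxy' : ∀ i, x ∈ (g i).1 ↔ y ∈ (g i).1 := fun i => by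
        have := congrArg (i ∈ ·) hxy
        simpa [v] using this
      -- Swapping two points with the same trace fixes all of `S`, yet moves any vertex containing
      -- `x` but not `y`.
      have hfix := hdet (kneserGraphIsoOfPerm (Equiv.swap x y)) (by
        intro s hs
        obtain ⟨i, rfl⟩ := hg s hs
        refine Subtype.ext (eq_of_subset_of_card_le ?_ ?_)
        · intro z hz
          obtain ⟨w, hw, rfl⟩ := mem_map.1 hz
          have := hxy' i
          rcases eq_or_ne w x with rfl | hwx
          · simpa [Equiv.swap_apply_left] using this.1 hw
          · rcases eq_or_ne w y with rfl | hwy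
            · simpa [Equiv.swap_apply_right] using this.2 hw
            · simpa [Equiv.swap_apply_of_ne_of_ne hwx hwy] using hw
        · rw [(g i).2, (kneserGraphIsoOfPerm (Equiv.swap x y) (g i)).2])
      obtain ⟨s, hxs, hsy, hs⟩ := exists_subsuperset_card_eq (s := {x})
        (t := (univ : Finset (Fin n)).erase y) (n := k) (by simpa using hne) (by simpa using hk)
        (by rw [card_erase_of_mem (mem_univ y), card_univ, Fintype.card_fin]; omega)
      have h1 : y ∈ (kneserGraphIsoOfPerm (Equiv.swap x y) ⟨s, hs⟩).1 :=
        mem_map.2 ⟨x, singleton_subset_iff.1 hxs, Equiv.swap_apply_left x y⟩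
      rw [hfix] at h1
      exact notMem_erase y _ (hsy h1)
    refine ⟨univ.image v, by rw [card_image_of_injective _ hv, card_univ, Fintype.card_fin], ?_⟩
    intro i
    rw [filter_image, card_image_of_injective _ hv, ← (g i).2]
    congr 1
    ext x
    simp [v]
  · rintro ⟨H, hH, hreg⟩
    let e : Fin n ≃ H := (H.equivFinOfCardEq hH).symm
    have hcard : ∀ i, #(univ.filter fun x => i ∈ (e x).1) = k := by
      intro i
      rw [← hreg i]
      refine card_bij (fun x _ => (e x).1) (fun x hx => ?_)
        (fun x _ y _ h => e.injective (Subtype.ext h)) (fun A hA => ?_)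
      · exact mem_filter.2 ⟨(e x).2, (mem_filter.1 hx).2⟩
      · rw [mem_filter] at hA
        exact ⟨e.symm ⟨A, hA.1⟩, by simpa using hA.2, by simp⟩
    let g : ι → {s : Finset (Fin n) // #s = k} := fun i => ⟨_, hcard i⟩
    -- Coincidences among the `g i` only make the determining set smaller.
    refine ⟨univ.image g, card_image_le.trans_eq card_univ, fun σ hσ => ?_⟩
    obtain ⟨π, hπ⟩ := exists_perm_of_kneserGraph_iso hk hn σ
    have hπ1 : ∀ x, π x = x := by
      intro x
      refine e.injective (Subtype.ext (Finset.ext fun i => ?_))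
      have h1 : (g i).1.image π = (g i).1 := by
        rw [← hπ, hσ _ (mem_image_of_mem _ (mem_univ i))]
      have h2 : ∀ z, z ∈ (g i).1 ↔ i ∈ (e z).1 := fun z => by simp [g]
      rw [← h2, ← h2]
      nth_rw 1 [← h1]
      exact π.injective.mem_finset_image
    intro s
    refine Subtype.ext ?_
    rw [hπ, show (π : Fin n → Fin n) = id from funext hπ1, image_id]

/-! ### Extending regular families by a point -/

theorem HasRegularFamily.card_le {ι : Type*} [Fintype ι] [DecidableEq ι] {n k : ℕ}
    (h : HasRegularFamily ι n k) : n ≤ 2 ^ Fintype.card ι := by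
  obtain ⟨H, rfl, -⟩ := h
  rw [← Fintype.card_finset]
  exact card_le_univ H

theorem card_filter_mem_and_notMem {ι : Type*} [Fintype ι] [DecidableEq ι] (i : ι) :
    #(univ.filter fun A : Finset ι => i ∈ A) = 2 ^ (Fintype.card ι - 1) ∧
      #(univ.filter fun A : Finset ι => i ∉ A) = 2 ^ (Fintype.card ι - 1) := by
  have h1 : #(univ.filter fun A : Finset ι => i ∈ A) = #(univ.filter fun A : Finset ι => i ∉ A) :=
    card_bij' (fun A _ => Aᶜ) (fun A _ => Aᶜ) (by simp) (by simp) (by simp) (by simp)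
  have h2 := card_filter_add_card_filter_not (s := univ) fun A : Finset ι => i ∈ A
  rw [card_univ, Fintype.card_finset] at h2
  have h3 : 2 ^ Fintype.card ι = 2 * 2 ^ (Fintype.card ι - 1) := by
    rw [← pow_succ', Nat.sub_add_cancel (Fintype.card_pos_iff.2 ⟨i⟩)]
  omega

/-- Adding a point: a `k`-regular family of `n` sets on `r ≥ 1` points yields a
`(2 ^ (r - 1) + k)`-regular family of `2 ^ r + n` sets on `r + 1` points. -/
theorem HasRegularFamily.option {ι : Type*} [Fintype ι] [DecidableEq ι] [Nonempty ι] {n k : ℕ}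
    (h : HasRegularFamily ι n k) :
    HasRegularFamily (Option ι) (2 ^ Fintype.card ι + n) (2 ^ (Fintype.card ι - 1) + k) := by
  obtain ⟨H, rfl, hreg⟩ := h
  obtain ⟨x⟩ := ‹Nonempty ι›
  -- `P` is kept without the new point, `Q` receives it. Since `P ∪ Q` is everything and `P ∩ Q =
  -- H`, old points get the right degree; splitting along `x` gives the new point the degree `#Q = 2
  -- ^ (r - 1) + k`.
  set P := univ.filter fun A : Finset ι => x ∈ A ∨ A ∈ H with hP
  set Q := univ.filter fun A : Finset ι => x ∉ A ∨ A ∈ H with hQ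
  let low : Finset ι → Finset (Option ι) := fun A => A.map Function.Embedding.some
  have hlow : Function.Injective low := map_injective _
  have hhigh : Function.Injective (fun A : Finset ι => insertNone A) := insertNone.injective
  have hPQ : P ∪ Q = univ := by ext A; simp [hP, hQ]; tauto
  have hPQ' : P ∩ Q = H := by ext A; simp [hP, hQ]; tauto
  have hdisj : ∀ p q : Finset (Finset ι), Disjoint (p.image low) (q.image fun A => insertNone A) := by
    intro p q
    rw [Finset.disjoint_left]
    intro B hB hB'
    obtain ⟨A, -, rfl⟩ := mem_image.1 hB
    obtain ⟨A', -, h⟩ := mem_image.1 hB'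
    have : none ∈ low A := h ▸ none_mem_insertNone
    simp [low] at this
  refine ⟨P.image low ∪ Q.image fun A => insertNone A, ?_, ?_⟩
  · rw [card_union_of_disjoint (hdisj _ _), card_image_of_injective _ hlow,
      card_image_of_injective _ hhigh, ← card_union_add_card_inter, hPQ, hPQ', card_univ,
      Fintype.card_finset]
  · intro i
    rw [filter_union, filter_image, filter_image, card_union_of_disjoint (hdisj _ _),
      card_image_of_injective _ hlow, card_image_of_injective _ hhigh]
    cases i with
    | none =>
      have h1 : P.filter (fun A => none ∈ low A) = ∅ := by simp [low]
      have h2 : Q.filter (fun A => none ∈ insertNone A) = Q := by simp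
      rw [h1, h2, card_empty, zero_add]
      have h3 : Q = (univ.filter fun A : Finset ι => x ∉ A) ∪ H.filter fun A => x ∈ A := by
        ext A
        simp [hQ]
        tauto
      rw [h3, card_union_of_disjoint, hreg, (card_filter_mem_and_notMem x).2]
      rw [Finset.disjoint_left]
      intro A hA hA'
      exact (mem_filter.1 hA).2 (mem_filter.1 hA').2
    | some i =>
      have h1 : P.filter (fun A => some i ∈ low A) = P.filter fun A => i ∈ A := by simp [low]
      have h2 : Q.filter (fun A => some i ∈ insertNone A) = Q.filter fun A => i ∈ A := by simp
      rw [h1, h2, ← card_union_add_card_inter, ← filter_union, ← filter_inter_distrib, hPQ, hPQ',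
        hreg, (card_filter_mem_and_notMem i).1]

theorem card_le_two_pow_of_determiningNumber_le {n k r : ℕ} (hk : 1 ≤ k) (hn : 2 * k < n)
    (h : determiningNumber (kneserGraph n k) ≤ r) : n ≤ 2 ^ r := by
  have := ((determiningNumber_kneserGraph_le_iff (ι := Fin r) hk hn).1
    (by rwa [Fintype.card_fin])).card_le
  rwa [Fintype.card_fin] at this

/-- The ground set has more than `2 ^ r` points, so `r` vertices cannot suffice. The case `k = 0` is
admitted for the sake of the family {∅}. -/
theorem HasRegularFamily.mem_kneserWithDet {n k r : ℕ} (hr : 1 ≤ r) (hn : 2 * k < n)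
    (h : HasRegularFamily (Fin r) n k) :
    (2 ^ r + n, 2 ^ (r - 1) + k) ∈ kneserWithDet (r + 1) := by
  have : Nonempty (Fin r) := ⟨⟨0, hr⟩⟩
  have hpow : 2 ^ r = 2 * 2 ^ (r - 1) := by rw [← pow_succ', Nat.sub_add_cancel hr]
  have hpos : 0 < 2 ^ (r - 1) := by positivity
  have hk' : 1 ≤ 2 ^ (r - 1) + k := by omega
  have hn' : 2 * (2 ^ (r - 1) + k) < 2 ^ r + n := by omega
  have h1 := h.option
  rw [Fintype.card_fin, ← determiningNumber_kneserGraph_le_iff hk' hn', Fintype.card_option,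
    Fintype.card_fin] at h1
  refine ⟨hk', hn', le_antisymm h1 (Nat.succ_le_of_lt (lt_of_not_ge fun hle => ?_))⟩
  have := card_le_two_pow_of_determiningNumber_le hk' hn' hle
  omega

/-! ### Counting -/

theorem kneserWithDetLE_finite (r : ℕ) : (kneserWithDetLE r).Finite := by
  refine ((Set.finite_Iic (2 ^ r)).prod (Set.finite_Iic (2 ^ r))).subset ?_
  rintro ⟨n, k⟩ ⟨hk, hn, h⟩
  have := card_le_two_pow_of_determiningNumber_le hk hn h
  simp only at hk hn
  exact ⟨this, show k ≤ 2 ^ r by omega⟩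

theorem kneserWithDet_finite (r : ℕ) : (kneserWithDet r).Finite :=
  (kneserWithDetLE_finite r).subset fun _ h => ⟨h.1, h.2.1, h.2.2.le⟩

theorem kneserCountLE_succ (r : ℕ) :
    kneserCountLE (r + 1) = kneserCountLE r + kneserCount (r + 1) := by
  have hunion : kneserWithDetLE (r + 1) = kneserWithDetLE r ∪ kneserWithDet (r + 1) := by
    ext p
    simp only [kneserWithDetLE, kneserWithDet, Set.mem_ofPred_eq, Set.mem_union, Nat.le_succ_iff]
    tauto
  rw [kneserCountLE, hunion, Set.ncard_union_eq _ (kneserWithDetLE_finite r)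
    (kneserWithDet_finite (r + 1))]
  · rfl
  · rw [Set.disjoint_left]
    rintro p ⟨-, -, h⟩ ⟨-, -, h'⟩
    omega

theorem kneserCountLE_one : kneserCountLE 1 = 0 := by
  rw [kneserCountLE, Set.ncard_eq_zero (kneserWithDetLE_finite 1), Set.eq_empty_iff_forall_notMem]
  rintro ⟨n, k⟩ ⟨hk, hn, h⟩
  have := card_le_two_pow_of_determiningNumber_le hk hn h
  simp only at hk hn
  omega

theorem sum_kneserCount (r : ℕ) (hr : 2 ≤ r) :
    ∑ k ∈ Finset.Icc 2 r, kneserCount k = kneserCountLE r := by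
  induction r, hr using Nat.le_induction with
  | base => simp [kneserCountLE_succ 1, kneserCountLE_one]
  | succ r hr ih => rw [sum_Icc_succ_top (by omega), ih, kneserCountLE_succ]

theorem kneserCountLE_lt_kneserCount_succ (r : ℕ) (hr : 1 ≤ r) :
    kneserCountLE r < kneserCount (r + 1) := by
  -- The extra pair, realized by {∅}, makes the inequality strict.
  have hnot : ((1, 0) : ℕ × ℕ) ∉ kneserWithDetLE r := fun h => Nat.not_succ_le_zero 0 h.1
  rw [← Nat.succ_le_iff, Nat.succ_eq_add_one, kneserCountLE,
    ← Set.ncard_insert_of_notMem hnot (kneserWithDetLE_finite r)]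
  refine Set.ncard_le_ncard_of_injOn (fun p => (2 ^ r + p.1, 2 ^ (r - 1) + p.2)) ?_ ?_
    (kneserWithDet_finite (r + 1))
  · rintro ⟨n, k⟩ (hp | ⟨hk, hn, h⟩)
    · obtain ⟨rfl, rfl⟩ := Prod.mk.inj hp
      exact HasRegularFamily.mem_kneserWithDet hr (by omega) ⟨{∅}, card_singleton _, by simp⟩
    · exact HasRegularFamily.mem_kneserWithDet hr hn
        ((determiningNumber_kneserGraph_le_iff hk hn).1 (by rwa [Fintype.card_fin]))
  · rintro ⟨n, k⟩ - ⟨n', k'⟩ - h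
    simpa using h

/-- The first conjunct says that the counts `f(r)` and `F(r)` are counts of finite sets. -/
theorem mainTheorem5 :
    (∀ r : ℕ, (kneserWithDetLE r).Finite ∧ (kneserWithDet r).Finite) ∧
    StrictMonoOn kneserCount (Set.Ici 2) ∧
    (∀ r : ℕ, 2 ≤ r → ∑ k ∈ Finset.Icc 2 r, kneserCount k ≤ kneserCount (r + 1)) ∧
    (∀ r : ℕ, 2 ≤ r → 2 * kneserCountLE r ≤ kneserCountLE (r + 1)) := by
  refine ⟨fun r => ⟨kneserWithDetLE_finite r, kneserWithDet_finite r⟩, ?_, fun r hr => ?_,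
    fun r hr => ?_⟩
  · have hstep : ∀ r, 2 ≤ r → kneserCount r < kneserCount (r + 1) := by
      intro r hr
      obtain ⟨r, rfl⟩ := Nat.exists_eq_add_of_le' (show 1 ≤ r by omega)
      -- `f(r+1) ≤ F(r+1) < f(r+2)`.
      have h1 := kneserCountLE_succ r
      have h2 := kneserCountLE_lt_kneserCount_succ (r + 1) (by omega)
      omega
    intro a ha b _ hab
    obtain ⟨a, rfl⟩ := Nat.exists_eq_add_of_le' (Set.mem_Ici.1 ha)
    obtain ⟨b, rfl⟩ := Nat.exists_eq_add_of_le' (show 2 ≤ b by have := Set.mem_Ici.1 ha; omega)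
    exact strictMono_nat_of_lt_succ (f := fun m => kneserCount (m + 2))
      (fun m => by simpa [add_right_comm] using hstep (m + 2) (by omega)) (by omega : a < b)
  · rw [sum_kneserCount r hr]
    exact (kneserCountLE_lt_kneserCount_succ r (by omega)).le
  · have h1 := kneserCountLE_succ r
    have h2 := kneserCountLE_lt_kneserCount_succ r (by omega)
    omega
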